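/- \textbf{Setting (targeted marketing).} Let $n\ge 1$ be the number of markets. In each round $t=1,2,\dots$ a firm chooses marketing expenditures $c_t=(c_{t,1},\dots,c_{t,n})\in[0,1]^n$ and a common price $p_t\in[0,1]$, and then observes demands $d_t=(d_{t,1},\dots,d_{t,n})\in[0,1]^n$ drawn from $D_t(c_t,p_t)$. An \emph{environment} is a sequence $\{D_t\}_t$ of (measurable) maps from $[0,1]^{n+1}$ to probability distributions on $[0,1]^n$, fixed in advance, such that the expectation of $d_{t,i}$ under $D_t(c,p)$ depends only on $c_i$ and $p$; it is denoted by $\overline d_{t,i}(c_i,p)$. The environment has \emph{monotonic demands} if every $\overline d_{t,i}(c_i,p)$ is non-decreasing in $c_i$ and non-increasing in $p$. An \emph{algorithm} $\mathcal A$ is a (measurable) map from each history $\{(c_\tau,p_\tau,d_\tau)\}_{\tau<t}$ to a probability distribution on $[0,1]^{n+1}$, from which $(c_t,p_t)$ is drawn. The expected regret after $T$ rounds is $$R_T(\mathcal A,\{D_t\}_t)=\sup_{(c,p)\in[0,1]^{n+1}}\sum_{t=1}^T\sum_{i=1}^n\bigl(p\,\overline d_{t,i}(c_i,p)-c_i\bigr)-\mathbb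 E\Bigl[\sum_{t=1}^T\sum_{i=1}^n\bigl(p_t\,d_{t,i}-c_{t,i}\bigr)\Bigr],$$ where the expectation is over the randomness of both the algorithm and the environment. \textbf{Theorem.} There is an absolute constant $\kappa>0$ such that for all integers $n\ge 1$ and $T\ge 1$, $$\inf_{\mathcal A}\ \sup_{\{D_t\}_t} R_T\bigl(\mathcal A,\{D_t\}_t\bigr)\ \ge\ \kappa\,(nT)^{3/4},$$ where the infimum is over all algorithms and the supremum is over all environments with monotonic demands. -/

import Mathlib

open MeasureTheory ProbabilityTheory
open scoped unitInterval

noncomputable section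

namespace TargetedMarketing

/-- The firm's choice in one round: expenditures `c i` for the `n` markets and a common price,
i.e. a point `(c, p)` of `[0,1]^{n+1}`. -/
abbrev Action (n : ℕ) : Type := (Fin n → I) × I

/-- The realized demands of one round, a point of `[0,1]^n`. -/
abbrev Demand (n : ℕ) : Type := Fin n → I

/-- What is recorded in one round: the chosen action and the realized demands. -/
abbrev Round (n : ℕ) : Type := Action n × Demand n

/-- The record of the first `t` rounds (rounds are numbered from `0`). -/
abbrev History (n t : ℕ) : Type := Fin t → Round n

/-- An (oblivious, possibly non-stationary) environment: in round `t` the action `a` yields demands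
with joint law `demandLaw t a`; the expected demand in market `i` depends only on the expenditure
for market `i` and on the price. -/
structure Environment (n : ℕ) where
  demandLaw : ℕ → Kernel (Action n) (Demand n)
  isMarkovKernel : ∀ t, IsMarkovKernel (demandLaw t)
  mean_congr : ∀ (t : ℕ) (i : Fin n) (c c' : Fin n → I) (p : I), c i = c' i →
    ∫ d, (d i : ℝ) ∂(demandLaw t (c, p)) = ∫ d, (d i : ℝ) ∂(demandLaw t (c', p))

instance {n : ℕ} (D : Environment n) (t : ℕ) : IsMarkovKernel (D.demandLaw t) :=
  D.isMarkovKernel t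

/-- A (randomized) algorithm: a map from the history of the first `t` rounds to a law for the
next action. -/
structure Algorithm (n : ℕ) where
  policy : (t : ℕ) → Kernel (History n t) (Action n)
  isMarkovKernel : ∀ t, IsMarkovKernel (policy t)

instance {n : ℕ} (A : Algorithm n) (t : ℕ) : IsMarkovKernel (A.policy t) :=
  A.isMarkovKernel t

namespace Environment

variable {n : ℕ}

/-- The expected demand in market `i` in round `t` at expenditure `x` for that market and
price `p`. The expenditures for the other markets are irrelevant (see `meanDemand_eq`). -/
def meanDemand (D : Environment n) (t : ℕ) (i : Fin n) (x p : I) : ℝ :=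
  ∫ d, (d i : ℝ) ∂(D.demandLaw t (fun _ => x, p))

theorem meanDemand_eq (D : Environment n) (t : ℕ) (i : Fin n) (c : Fin n → I) (p : I) :
    ∫ d, (d i : ℝ) ∂(D.demandLaw t (c, p)) = D.meanDemand t i (c i) p :=
  D.mean_congr t i c (fun _ => c i) p rfl

/-- Monotonic demands: every expected demand function is non-decreasing in the expenditure and
non-increasing in the price. -/
def Monotonic (D : Environment n) : Prop :=
  ∀ (t : ℕ) (i : Fin n),
    (∀ p : I, Monotone fun x : I => D.meanDemand t i x p) ∧
    (∀ x : I, Antitone fun p : I => D.meanDemand t i x p)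

/-- The expected total profit, over the first `T` rounds and all markets, of playing the fixed
action `a` in every round. -/
def fixedProfit (D : Environment n) (T : ℕ) (a : Action n) : ℝ :=
  ∑ t ∈ Finset.range T, ∑ i : Fin n, ((a.2 : ℝ) * D.meanDemand t i (a.1 i) a.2 - (a.1 i : ℝ))

/-- The best expected total profit of a fixed action in hindsight. The supremum is over a nonempty
set of reals that is bounded above (see `bddAbove_fixedProfit`). -/
def opt (D : Environment n) (T : ℕ) : ℝ := ⨆ a : Action n, D.fixedProfit T a

theorem meanDemand_le_one (D : Environment n) (t : ℕ) (i : Fin n) (x p : I) :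
    D.meanDemand t i x p ≤ 1 := by
  unfold meanDemand
  have h := integral_mono_of_nonneg (μ := D.demandLaw t (fun _ => x, p))
    (f := fun d : Demand n => (d i : ℝ)) (g := fun _ => (1 : ℝ))
    (Filter.Eventually.of_forall fun d => (d i).2.1) (integrable_const _)
    (Filter.Eventually.of_forall fun d => (d i).2.2)
  simpa using h

theorem bddAbove_fixedProfit (D : Environment n) (T : ℕ) :
    BddAbove (Set.range (D.fixedProfit T)) := by
  refine ⟨∑ t ∈ Finset.range T, ∑ i : Fin n, (1 : ℝ), ?_⟩
  rintro _ ⟨a, rfl⟩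
  refine Finset.sum_le_sum fun t _ => Finset.sum_le_sum fun i _ => ?_
  have h1 := D.meanDemand_le_one t i (a.1 i) a.2
  have h2 := a.2.2.1
  have h3 := a.2.2.2
  have h4 := (a.1 i).2.1
  nlinarith [mul_le_mul_of_nonneg_left h1 h2]

end Environment

variable {n : ℕ}

/-- One round of play after a history of length `t`: the action is drawn from the algorithm's
policy, and then the demands are drawn from the environment at that action. -/
def roundKernel (A : Algorithm n) (D : Environment n) (t : ℕ) :
    Kernel (History n t) (Round n) :=
  A.policy t ⊗ₖ (D.demandLaw t).prodMkLeft (History n t)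

instance (A : Algorithm n) (D : Environment n) (t : ℕ) : IsMarkovKernel (roundKernel A D t) := by
  unfold roundKernel
  infer_instance

/-- Append a round to a history. -/
def appendRound (t : ℕ) (x : History n t × Round n) : History n (t + 1) :=
  Fin.snoc (α := fun _ => Round n) x.1 x.2

theorem measurable_appendRound (t : ℕ) : Measurable (appendRound (n := n) t) := by
  refine measurable_pi_iff.2 fun i => ?_
  refine Fin.lastCases ?_ (fun j => ?_) i
  · simpa [appendRound] using measurable_snd
  · simpa [appendRound, Function.comp_def] using (measurable_pi_apply j).comp measurable_fst

/-- The law of the history of the first `t` rounds when `A` interacts with `D`. -/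
def historyLaw (A : Algorithm n) (D : Environment n) : (t : ℕ) → Measure (History n t)
  | 0 => Measure.dirac Fin.elim0
  | t + 1 => (historyLaw A D t ⊗ₘ roundKernel A D t).map (appendRound t)

instance isProbabilityMeasure_historyLaw (A : Algorithm n) (D : Environment n) (t : ℕ) :
    IsProbabilityMeasure (historyLaw A D t) := by
  induction t with
  | zero => exact Measure.dirac.isProbabilityMeasure
  | succ t ih => exact Measure.isProbabilityMeasure_map (measurable_appendRound t).aemeasurable

/-- The realized total profit along a history: the sum of `p_t * d_{t,i} - c_{t,i}` over all
rounds and markets. -/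
def realizedProfit {T : ℕ} (h : History n T) : ℝ :=
  ∑ t : Fin T, ∑ i : Fin n, (((h t).1.2 : ℝ) * ((h t).2 i : ℝ) - ((h t).1.1 i : ℝ))

/-- The expected regret of `A` against `D` after `T` rounds. -/
def regret (A : Algorithm n) (D : Environment n) (T : ℕ) : ℝ :=
  D.opt T - ∫ h, realizedProfit h ∂(historyLaw A D T)

theorem integrable_realizedProfit (A : Algorithm n) (D : Environment n) (T : ℕ) :
    Integrable (fun h : History n T => realizedProfit h) (historyLaw A D T) := by
  unfold realizedProfit
  refine integrable_finsetSum _ fun t _ => integrable_finsetSum _ fun i _ => ?_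
  refine Integrable.of_bound (C := 1) (Measurable.aestronglyMeasurable (by fun_prop))
    (Filter.Eventually.of_forall fun h => ?_)
  have h1 := (h t).1.2.2
  have h2 := ((h t).2 i).2
  have h3 := ((h t).1.1 i).2
  rw [Real.norm_eq_abs, abs_le]
  constructor <;>
    nlinarith [mul_nonneg h1.1 h2.1, mul_le_mul_of_nonneg_left h2.2 h1.1, h1.2, h3.1, h3.2]

/-- The minimax regret under monotonic demands: the infimum over all algorithms of the supremum
over all environments with monotonic demands of the expected regret after `T` rounds, as an
extended real. -/
def minimaxRegret (n T : ℕ) : EReal :=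
  ⨅ A : Algorithm n, ⨆ D : {D : Environment n // D.Monotonic}, (regret A D.1 T : EReal)

end TargetedMarketing

end

open MeasureTheory ProbabilityTheory
open scoped unitInterval

noncomputable section

namespace TargetedMarketing

variable {n : ℕ}

/-! Take a base mean demand for which every expenditure at most 1/8 and every price at least 1/2
earn exactly 1/4 per market and round. Hide in it one small bump, on one of `K * K` cells of side of
order `1/K`. Since the base demand has slope at least 1 in the expenditure and at most -1/4 in the
price, a bump of slope at most 1/4 keeps demands monotonic, so its height `δ` can be of order `1/K`.

Every market in every round is one observation of the same demand function, so there are `n * T` of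
them. By averaging, some cell receives at most `n * T / K ^ 2` visits in expectation under the base
environment (`exists_cell_few_visits`). Only visits to that cell distinguish the two environments,
each contributing relative entropy of order `δ ^ 2`. If `n * T ≤ K ^ 4`, the total is of order `δ ^
2 * K ^ 2`, a small constant, so under the bump the cell is still visited only a fraction of the
time (`integral_visits_le`). Each remaining observation loses order `δ`, and `K` of order `(n * T) ^
(1/4)` gives regret of order `n * T / K = (n * T) ^ (3/4)`.

The comparison is a change of measure along histories (`lintegral_historyLaw_of_density`), where the
policy cancels, followed by a Pinsker-type bound (`integral_abs_sub_one_le`). -/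

/-! ### Laws of histories: change of measure and sums over rounds. -/

theorem lintegral_roundKernel (A : Algorithm n) (D : Environment n) (t : ℕ) (h : History n t)
    {f : Round n → ENNReal} (hf : Measurable f) :
    ∫⁻ x, f x ∂(roundKernel A D t h) =
      ∫⁻ a, ∫⁻ d, f (a, d) ∂(D.demandLaw t a) ∂(A.policy t h) := by
  unfold roundKernel
  rw [Kernel.lintegral_compProd _ _ _ hf]
  rfl

theorem integral_roundKernel (A : Algorithm n) (D : Environment n) (t : ℕ) (h : History n t)
    {f : Round n → ℝ} (hf : Integrable f (roundKernel A D t h)) :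
    ∫ x, f x ∂(roundKernel A D t h) =
      ∫ a, ∫ d, f (a, d) ∂(D.demandLaw t a) ∂(A.policy t h) := by
  unfold roundKernel at hf ⊢
  rw [ProbabilityTheory.integral_compProd hf]
  rfl

theorem lintegral_historyLaw_succ (A : Algorithm n) (D : Environment n) (t : ℕ)
    {f : History n (t + 1) → ENNReal} (hf : Measurable f) :
    ∫⁻ h, f h ∂(historyLaw A D (t + 1)) =
      ∫⁻ h, ∫⁻ x, f (appendRound t (h, x)) ∂(roundKernel A D t h) ∂(historyLaw A D t) := by
  have hm : Measurable fun x => f (appendRound t x) := hf.comp (measurable_appendRound t)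
  rw [historyLaw, lintegral_map hf (measurable_appendRound t), Measure.lintegral_compProd hm]

/-- If two environments differ by the density `ρ` of the demands in each round, then the laws of
the histories differ by the product of these densities. -/
theorem lintegral_historyLaw_of_density (A : Algorithm n) (D D' : Environment n)
    {ρ : Round n → ENNReal} (hρ : Measurable ρ)
    (hD : ∀ t a, D'.demandLaw t a = (D.demandLaw t a).withDensity fun d => ρ (a, d)) (T : ℕ)
    {f : History n T → ENNReal} (hf : Measurable f) :
    ∫⁻ h, f h ∂(historyLaw A D' T) =
      ∫⁻ h, (∏ t, ρ (h t)) * f h ∂(historyLaw A D T) := by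
  induction T with
  | zero => simp [historyLaw]
  | succ T ih =>
    have key (h : History n T) : ∫⁻ x, f (appendRound T (h, x)) ∂(roundKernel A D' T h) =
        ∫⁻ x, ρ x * f (appendRound T (h, x)) ∂(roundKernel A D T h) := by
      have hm : Measurable fun x => f (appendRound T (h, x)) :=
        hf.comp ((measurable_appendRound T).comp measurable_prodMk_left)
      have hm' : Measurable fun x => ρ x * f (appendRound T (h, x)) := hρ.mul hm
      rw [lintegral_roundKernel _ _ _ _ hm, lintegral_roundKernel _ _ _ _ hm']
      refine lintegral_congr fun a => ?_
      rw [hD]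
      exact lintegral_withDensity_eq_lintegral_mul _ (hρ.comp measurable_prodMk_left)
        (hm.comp measurable_prodMk_left)
    have hm : Measurable fun x : History n T × Round n => f (appendRound T x) :=
      hf.comp (measurable_appendRound T)
    -- The induction hypothesis is applied to the conditional expectation of `f` given the first `T`
    -- rounds.
    rw [lintegral_historyLaw_succ _ _ _ hf, ih (Measurable.lintegral_kernel_prod_right hm),
      lintegral_historyLaw_succ _ _ _ (by fun_prop)]
    refine lintegral_congr fun h => ?_
    have hm' : Measurable fun x => ρ x * f (appendRound T (h, x)) :=
      hρ.mul (hm.comp measurable_prodMk_left)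
    rw [key, ← lintegral_const_mul _ hm']
    refine lintegral_congr fun x => ?_
    simp [Fin.prod_univ_castSucc, appendRound, mul_assoc]

theorem integrable_of_measurable_bounded {α : Type*} [MeasurableSpace α] {μ : Measure α}
    [IsFiniteMeasure μ] {f : α → ℝ} (hf : Measurable f) {C : ℝ} (hC : ∀ x, |f x| ≤ C) :
    Integrable f μ :=
  Integrable.of_bound hf.aestronglyMeasurable C (Filter.Eventually.of_forall hC)

theorem integrable_sum_rounds (A : Algorithm n) (D : Environment n) (T : ℕ) {g : Round n → ℝ}
    (hg : Measurable g) {C : ℝ} (hC : ∀ x, |g x| ≤ C) :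
    Integrable (fun h : History n T => ∑ t, g (h t)) (historyLaw A D T) :=
  integrable_finsetSum _ fun t _ =>
    integrable_of_measurable_bounded (hg.comp (measurable_pi_apply t)) fun h => hC (h t)

theorem integral_sum_rounds_succ (A : Algorithm n) (D : Environment n) (T : ℕ) {g : Round n → ℝ}
    (hg : Measurable g) {C : ℝ} (hC : ∀ x, |g x| ≤ C) :
    ∫ h, ∑ t, g (h t) ∂(historyLaw A D (T + 1)) =
      ∫ h, ∑ t, g (h t) ∂(historyLaw A D T) +
        ∫ h, ∫ a, ∫ d, g (a, d) ∂(D.demandLaw T a) ∂(A.policy T h) ∂(historyLaw A D T) := by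
  have hm : Measurable fun h : History n (T + 1) => ∑ t, g (h t) := by fun_prop
  have hint : Integrable (fun x : History n T × Round n => g x.2)
      (historyLaw A D T ⊗ₘ roundKernel A D T) :=
    integrable_of_measurable_bounded (hg.comp measurable_snd) fun x => hC x.2
  have hint' : Integrable (fun x : History n T × Round n => ∑ t, g (x.1 t))
      (historyLaw A D T ⊗ₘ roundKernel A D T) :=
    integrable_finsetSum _ fun t _ => integrable_of_measurable_bounded (by fun_prop)
      fun x => hC (x.1 t)
  rw [historyLaw, integral_map (measurable_appendRound T).aemeasurable hm.aestronglyMeasurable]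
  simp only [Fin.sum_univ_castSucc, appendRound, Fin.snoc_castSucc, Fin.snoc_last]
  rw [integral_add hint' hint, Measure.integral_compProd hint, Measure.integral_compProd hint']
  congr 1
  · simp
  · refine integral_congr_ae (Filter.Eventually.of_forall fun h => ?_)
    exact integral_roundKernel A D T h (integrable_of_measurable_bounded hg hC)

/-- Comparison of expected sums over the rounds when the expectations given the current action
are comparable. -/
theorem integral_sum_rounds_mono (A : Algorithm n) (D : Environment n) (T : ℕ)
    {g g' : Round n → ℝ} (hg : Measurable g) (hg' : Measurable g') {C C' : ℝ}
    (hC : ∀ x, |g x| ≤ C) (hC' : ∀ x, |g' x| ≤ C')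
    (hle : ∀ t a, ∫ d, g (a, d) ∂(D.demandLaw t a) ≤ ∫ d, g' (a, d) ∂(D.demandLaw t a)) :
    ∫ h, ∑ t, g (h t) ∂(historyLaw A D T) ≤ ∫ h, ∑ t, g' (h t) ∂(historyLaw A D T) := by
  induction T with
  | zero => simp
  | succ T ih =>
    rw [integral_sum_rounds_succ A D T hg hC, integral_sum_rounds_succ A D T hg' hC']
    have aux {f : Round n → ℝ} {c : ℝ} (hf : Measurable f) (hc : ∀ x, |f x| ≤ c) :
        (∀ h, Integrable (fun a => ∫ d, f (a, d) ∂(D.demandLaw T a)) (A.policy T h)) ∧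
        Integrable (fun h => ∫ a, ∫ d, f (a, d) ∂(D.demandLaw T a) ∂(A.policy T h))
          (historyLaw A D T) := by
      have h1 (a : Action n) : |∫ d, f (a, d) ∂(D.demandLaw T a)| ≤ c := by
        simpa using norm_integral_le_of_norm_le_const (μ := D.demandLaw T a)
          (f := fun d => f (a, d)) (Filter.Eventually.of_forall fun d => hc (a, d))
      have m1 : StronglyMeasurable fun a => ∫ d, f (a, d) ∂(D.demandLaw T a) :=
        hf.stronglyMeasurable.integral_kernel_prod_right'
      refine ⟨fun h => integrable_of_measurable_bounded m1.measurable h1, ?_⟩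
      refine integrable_of_measurable_bounded (C := c) ?_ fun h => ?_
      · have := StronglyMeasurable.integral_kernel_prod_right' (κ := A.policy T)
          (m1.comp_measurable measurable_snd)
        exact this.measurable
      · simpa using norm_integral_le_of_norm_le_const (μ := A.policy T h)
          (f := fun a => ∫ d, f (a, d) ∂(D.demandLaw T a)) (Filter.Eventually.of_forall h1)
    refine add_le_add ih (integral_mono (aux hg hC).2 (aux hg' hC').2 fun h => ?_)
    exact integral_mono ((aux hg hC).1 h) ((aux hg' hC').1 h) fun a => hle T a

/-! ### Bernoulli demands and their likelihood ratios. -/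

theorem measurable_bernoulliMeasure {X : Type*} [MeasurableSpace X] (x y : X) :
    Measurable fun q : I => bernoulliMeasure x y q := by
  refine Measure.measurable_of_measurable_coe _ fun s hs => ?_
  classical
  simp_rw [bernoulliMeasure_apply _ hs]
  split_ifs
  · fun_prop
  · exact measurable_coe_nnreal_ennreal.comp (by fun_prop)
  · exact measurable_coe_nnreal_ennreal.comp (by fun_prop)
  · fun_prop

/-- The kernel of independent Bernoulli demands, with mean `q x p` in a market with expenditure `x`
at the price `p`. -/
def bernoulliDemand (n : ℕ) (q : I × I → I) (hq : Measurable q) :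
    Kernel (Action n) (Demand n) where
  toFun a := Measure.pi fun i => bernoulliMeasure 1 0 (q (a.1 i, a.2))
  measurable' := by
    refine Measurable.measure_of_isPiSystem_of_isProbabilityMeasure
      generateFrom_pi.symm isPiSystem_pi ?_
    rintro _ ⟨s, hs, rfl⟩
    simp only [Measure.pi_pi]
    refine Finset.measurable_prod _ fun i _ => ?_
    exact (Measure.measurable_coe (show MeasurableSet (s i) from hs i (Set.mem_univ i))).comp
      ((measurable_bernoulliMeasure 1 0).comp (by fun_prop))

instance (q : I × I → I) (hq : Measurable q) : IsMarkovKernel (bernoulliDemand n q hq) :=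
  ⟨fun a => by change IsProbabilityMeasure (Measure.pi _); infer_instance⟩

theorem integral_bernoulliDemand (q : I × I → I) (hq : Measurable q) (a : Action n) (i : Fin n)
    {g : I → ℝ} (hg : Measurable g) :
    ∫ d, g (d i) ∂(bernoulliDemand n q hq a) =
      (q (a.1 i, a.2) : ℝ) * g 1 + (1 - q (a.1 i, a.2) : ℝ) * g 0 := by
  have h := (measurePreserving_eval (fun j => bernoulliMeasure (1 : I) 0 (q (a.1 j, a.2))) i)
  have e := integral_bernoulliMeasure (1 : I) 0 (q (a.1 i, a.2)) g
  rw [← h.map_eq, integral_map h.measurable.aemeasurable hg.aestronglyMeasurable] at e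
  exact e

theorem integral_sum_bernoulliDemand (q : I × I → I) (hq : Measurable q) (a : Action n)
    {g : Fin n → I → ℝ} (hg : ∀ i, Measurable (g i)) {C : ℝ} (hC : ∀ i x, |g i x| ≤ C) :
    ∫ d, ∑ i, g i (d i) ∂(bernoulliDemand n q hq a) =
      ∑ i, ((q (a.1 i, a.2) : ℝ) * g i 1 + (1 - q (a.1 i, a.2) : ℝ) * g i 0) := by
  have hint (i : Fin n) : Integrable (fun d : Demand n => g i (d i)) (bernoulliDemand n q hq a) :=
    integrable_of_measurable_bounded ((hg i).comp (measurable_pi_apply i)) fun d => hC i (d i)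
  rw [integral_finsetSum _ fun i _ => hint i]
  exact Finset.sum_congr rfl fun i _ => integral_bernoulliDemand q hq a i (hg i)

/-- The stationary environment with independent Bernoulli demands of mean `q`. -/
def bernoulliEnv (n : ℕ) (q : I × I → I) (hq : Measurable q) : Environment n where
  demandLaw _ := bernoulliDemand n q hq
  isMarkovKernel _ := inferInstance
  mean_congr t i c c' p h := by
    rw [integral_bernoulliDemand q hq _ i measurable_subtype_coe,
      integral_bernoulliDemand q hq _ i measurable_subtype_coe]
    simp [h]

theorem meanDemand_bernoulliEnv (q : I × I → I) (hq : Measurable q) (t : ℕ) (i : Fin n)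
    (x p : I) : (bernoulliEnv n q hq).meanDemand t i x p = q (x, p) := by
  refine (integral_bernoulliDemand q hq _ i measurable_subtype_coe).trans ?_
  simp

/-- The likelihood ratio of the Bernoulli laws with means `q'` and `q`, in the form of an affine
function of the outcome. -/
def bernoulliRatio (q q' x : ℝ) : ℝ := 1 + (q' - q) * (x - q) / (q * (1 - q))

theorem bernoulliRatio_one {q q' : ℝ} (h0 : 0 < q) (h1 : q < 1) :
    q * bernoulliRatio q q' 1 = q' := by
  have : 1 - q ≠ 0 := by linarith
  unfold bernoulliRatio
  field_simp
  ring

theorem bernoulliRatio_zero {q q' : ℝ} (h0 : 0 < q) (h1 : q < 1) :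
    (1 - q) * bernoulliRatio q q' 0 = 1 - q' := by
  have : 1 - q ≠ 0 := by linarith
  unfold bernoulliRatio
  field_simp
  ring

/-- A product measure is determined by its values on boxes, where the integral of the product
density factorizes; each factor reduces to the weights of the two atoms. -/
theorem pi_bernoulliMeasure_eq_withDensity {ι : Type*} [Fintype ι] (q q' : ι → I)
    (h0 : ∀ i, 0 < q i) (h1 : ∀ i, q i < 1) (hr : ∀ i (x : I), 0 ≤ bernoulliRatio (q i) (q' i) x) :
    Measure.pi (fun i => bernoulliMeasure (1 : I) 0 (q' i)) =
      (Measure.pi fun i => bernoulliMeasure (1 : I) 0 (q i)).withDensity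
        fun d => ENNReal.ofReal (∏ i, bernoulliRatio (q i) (q' i) (d i)) := by
  have hm : Measurable fun d : ι → I => ∏ i, bernoulliRatio (q i) (q' i) (d i) := by
    unfold bernoulliRatio
    fun_prop
  refine Measure.pi_eq fun s hs => ?_
  rw [withDensity_apply _ (MeasurableSet.univ_pi hs), Measure.restrict_pi_pi,
    ← ofReal_integral_eq_lintegral_ofReal
      (Integrable.fintype_prod_dep (f := fun i (x : I) => bernoulliRatio (q i) (q' i) x)
        fun i => (integrable_bernoulliMeasure _ _ _ _).restrict)
      (Filter.Eventually.of_forall fun d => Finset.prod_nonneg fun i _ => hr i (d i)),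
    integral_fintype_prod_eq_prod (𝕜 := ℝ) (fun i (x : I) => bernoulliRatio (q i) (q' i) x),
    ENNReal.ofReal_prod_of_nonneg fun i _ => integral_nonneg fun x => hr i x]
  refine Finset.prod_congr rfl fun i _ => ?_
  classical
  rw [← ofReal_measureReal, bernoulliMeasure_real_apply _ (hs i), ← integral_indicator (hs i),
    integral_bernoulliMeasure]
  have e1 := bernoulliRatio_one (q' := q' i) (h0 i) (h1 i)
  have e0 := bernoulliRatio_zero (q' := q' i) (h0 i) (h1 i)
  congr 1
  by_cases h : (1 : I) ∈ s i <;> by_cases h' : (0 : I) ∈ s i <;> simp [h, h', e1, e0]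

/-! ### Relative entropy and total variation. -/

/-- For a likelihood ratio `r` the linear term has mean zero, so the relative entropy is bounded by
twice the chi-square divergence. -/
theorem neg_log_le_of_half_le {r : ℝ} (hr : 1 / 2 ≤ r) :
    -Real.log r ≤ (1 - r) + 2 * (1 - r) ^ 2 := by
  have h := Real.one_sub_inv_le_log_of_pos (show 0 < r by linarith)
  have h2 : r⁻¹ ≤ 2 := by
    rw [inv_le_comm₀ (by linarith) (by norm_num)]; linarith
  have h3 : r⁻¹ - 1 - (1 - r) = (1 - r) ^ 2 * r⁻¹ := by
    have : r ≠ 0 := by linarith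
    field_simp
  nlinarith [mul_le_mul_of_nonneg_left h2 (sq_nonneg (1 - r))]

/-- A pointwise form of Pinsker's inequality through the Hellinger distance. With `x = y ^ 2`, the
bound `log y ≤ y - 1` controls `(y - 1) ^ 2` by `x - 1 + l`, and the inequality of arithmetic and
geometric means with parameter `s` splits `|y - 1| * (y + 1)`. -/
theorem abs_sub_one_le_of_neg_log_le {x l s : ℝ} (hx : 0 < x) (hl : -Real.log x ≤ l) (hs : 0 < s) :
    |x - 1| ≤ (x - 1 + l) / (2 * s) + s * (x + 1) := by
  obtain ⟨y, hy, rfl⟩ : ∃ y : ℝ, 0 < y ∧ x = y ^ 2 :=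
    ⟨√x, Real.sqrt_pos.2 hx, (Real.sq_sqrt hx.le).symm⟩
  have h1 : (y - 1) ^ 2 ≤ y ^ 2 - 1 + l := by
    have := Real.log_le_sub_one_of_pos hy
    rw [Real.log_pow] at hl
    push_cast at hl
    linarith
  have h2 : |y ^ 2 - 1| = |y - 1| * (y + 1) := by
    rw [show y ^ 2 - 1 = (y - 1) * (y + 1) by ring, abs_mul,
      abs_of_pos (show 0 < y + 1 by linarith)]
  have h3 : |y - 1| * (y + 1) ≤ (y - 1) ^ 2 / (2 * s) + s * (y + 1) ^ 2 / 2 := by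
    rw [← sq_abs (y - 1), ← sub_nonneg]
    have : |y - 1| ^ 2 / (2 * s) + s * (y + 1) ^ 2 / 2 - |y - 1| * (y + 1) =
        (|y - 1| - s * (y + 1)) ^ 2 / (2 * s) := by
      field_simp
      ring
    rw [this]
    positivity
  have h4 : (y - 1) ^ 2 / (2 * s) ≤ (y ^ 2 - 1 + l) / (2 * s) := by gcongr
  nlinarith [mul_nonneg hs.le (sq_nonneg (y - 1))]

/-- The total variation between two laws with likelihood ratio `L` is controlled by the relative
entropy, here through a bound `l` of `-log L`. -/
theorem integral_abs_sub_one_le {α : Type*} [MeasurableSpace α] {μ : Measure α}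
    [IsProbabilityMeasure μ] {L l : α → ℝ} (hL : Integrable L μ) (hl : Integrable l μ)
    (hpos : ∀ x, 0 < L x) (hone : ∫ x, L x ∂μ = 1) (hle : ∀ x, -Real.log (L x) ≤ l x)
    {s : ℝ} (hs : 0 < s) :
    ∫ x, |L x - 1| ∂μ ≤ (∫ x, l x ∂μ) / (2 * s) + 2 * s := by
  have i1 : Integrable (fun x => L x - 1) μ := hL.sub (integrable_const _)
  have i2 : Integrable (fun x => (L x - 1 + l x) / (2 * s)) μ := (i1.add hl).div_const _
  have i3 : Integrable (fun x => s * (L x + 1)) μ := (hL.add (integrable_const _)).const_mul _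
  calc ∫ x, |L x - 1| ∂μ ≤ ∫ x, ((L x - 1 + l x) / (2 * s) + s * (L x + 1)) ∂μ :=
        integral_mono i1.abs (i2.add i3) fun x => abs_sub_one_le_of_neg_log_le (hpos x) (hle x) hs
    _ = _ := by
      rw [integral_add i2 i3, integral_div, integral_const_mul, integral_add i1 hl,
        integral_sub hL (integrable_const _), integral_add hL (integrable_const _), hone]
      simp
      ring

/-! ### Comparison of visits in two environments. -/

/-- The total weight of the cells visited by the `n` markets in one round. -/
def visits (φ : I × I → ℝ) (x : Round n) : ℝ := ∑ i, φ (x.1.1 i, x.1.2)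

theorem measurable_visits {φ : I × I → ℝ} (hφ : Measurable φ) :
    Measurable (visits (n := n) φ) := by
  unfold visits
  fun_prop

theorem visits_nonneg {φ : I × I → ℝ} (h0 : ∀ y, 0 ≤ φ y) (x : Round n) : 0 ≤ visits φ x :=
  Finset.sum_nonneg fun _ _ => h0 _

theorem visits_le {φ : I × I → ℝ} (h1 : ∀ y, φ y ≤ 1) (x : Round n) : visits φ x ≤ n := by
  refine (Finset.sum_le_card_nsmul Finset.univ _ 1 fun i _ => h1 (x.1.1 i, x.1.2)).trans ?_
  simp

/-- The likelihood ratio of the demands in one round. -/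
def roundRatio (q q' : I × I → I) (x : Round n) : ℝ :=
  ∏ i, bernoulliRatio (q (x.1.1 i, x.1.2)) (q' (x.1.1 i, x.1.2)) (x.2 i)

section TwoPoint

variable {q q' : I × I → I} {φ : I × I → ℝ} {δ : ℝ}

theorem abs_bernoulliRatio_sub_one_le {q q' x ε : ℝ} (h : 1 / 4 ≤ q) (h' : q ≤ 3 / 4)
    (hε : |q' - q| ≤ ε) (hx0 : 0 ≤ x) (hx1 : x ≤ 1) :
    |bernoulliRatio q q' x - 1| ≤ 6 * ε := by
  have hv : 3 / 16 ≤ q * (1 - q) := by nlinarith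
  have hx : |x - q| ≤ 1 := by rw [abs_le]; constructor <;> linarith
  have : |q' - q| * |x - q| ≤ ε * 1 := mul_le_mul hε hx (abs_nonneg _) ((abs_nonneg _).trans hε)
  have h0 := (abs_nonneg _).trans hε
  unfold bernoulliRatio
  rw [add_sub_cancel_left, abs_div, abs_mul, abs_of_pos (show 0 < q * (1 - q) by linarith),
    div_le_iff₀ (by linarith)]
  nlinarith

/-- This is the mean of the bound in `neg_log_le_of_half_le` under the base law: the linear terms
cancel and twice the chi-square divergence remains. -/
theorem bernoulliRatio_second_moment {q q' : ℝ} (h0 : 0 < q) (h1 : q < 1) :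
    q * ((1 - bernoulliRatio q q' 1) + 2 * (1 - bernoulliRatio q q' 1) ^ 2) +
      (1 - q) * ((1 - bernoulliRatio q q' 0) + 2 * (1 - bernoulliRatio q q' 0) ^ 2) =
      2 * (q' - q) ^ 2 / (q * (1 - q)) := by
  have : 1 - q ≠ 0 := by linarith
  unfold bernoulliRatio
  field_simp
  ring

theorem half_le_bernoulliRatio (hq : ∀ y, (1 / 4 : ℝ) ≤ q y ∧ (q y : ℝ) ≤ 3 / 4)
    (hφ0 : ∀ y, 0 ≤ φ y) (hφ1 : ∀ y, φ y ≤ 1) (hδ0 : 0 ≤ δ) (hδ1 : δ ≤ 1 / 12)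
    (hqq' : ∀ y, (q' y : ℝ) = q y + δ * φ y) (y : I × I) (x : I) :
    1 / 2 ≤ bernoulliRatio (q y) (q' y) x ∧ bernoulliRatio (q y) (q' y) x ≤ 3 / 2 := by
  have h : |(q' y : ℝ) - q y| ≤ 1 / 12 := by
    rw [hqq', add_sub_cancel_left, abs_of_nonneg (mul_nonneg hδ0 (hφ0 y))]
    nlinarith [hφ0 y, hφ1 y]
  have := abs_le.1 (abs_bernoulliRatio_sub_one_le (hq y).1 (hq y).2 h x.2.1 x.2.2)
  constructor <;> linarith

theorem measurable_roundRatio (hqm : Measurable q) (hqm' : Measurable q') :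
    Measurable (roundRatio (n := n) q q') := by
  unfold roundRatio bernoulliRatio
  fun_prop

/-- Expected visits under the perturbed environment exceed those under the base environment by
little, as long as the latter are few. -/
theorem integral_visits_le (A : Algorithm n) (T : ℕ) (hqm : Measurable q) (hqm' : Measurable q')
    (hφm : Measurable φ) (hq : ∀ y, (1 / 4 : ℝ) ≤ q y ∧ (q y : ℝ) ≤ 3 / 4)
    (hφ0 : ∀ y, 0 ≤ φ y) (hφ1 : ∀ y, φ y ≤ 1) (hδ0 : 0 ≤ δ) (hδ1 : δ ≤ 1 / 12)
    (hqq' : ∀ y, (q' y : ℝ) = q y + δ * φ y) {s : ℝ} (hs : 0 < s) :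
    ∫ h, ∑ t, visits φ (h t) ∂(historyLaw A (bernoulliEnv n q' hqm') T) ≤
      ∫ h, ∑ t, visits φ (h t) ∂(historyLaw A (bernoulliEnv n q hqm) T) +
      n * T * (12 * δ ^ 2 * (∫ h, ∑ t, visits φ (h t) ∂(historyLaw A (bernoulliEnv n q hqm) T))
        / (2 * s) + 2 * s) := by
  set D := bernoulliEnv n q hqm
  set D' := bernoulliEnv n q' hqm'
  set μ := historyLaw A D T
  have hr := half_le_bernoulliRatio hq hφ0 hφ1 hδ0 hδ1 hqq'
  have hR0 (x : Round n) : 0 < roundRatio q q' x :=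
    Finset.prod_pos fun i _ => by linarith [(hr (x.1.1 i, x.1.2) (x.2 i)).1]
  -- This crude bound serves only the integrability of `L`.
  have hR1 (x : Round n) : roundRatio q q' x ≤ (3 / 2) ^ n := by
    refine (Finset.prod_le_prod (s := Finset.univ)
      (fun i _ => by linarith [(hr (x.1.1 i, x.1.2) (x.2 i)).1])
      (fun i _ => (hr (x.1.1 i, x.1.2) (x.2 i)).2)).trans ?_
    rw [Finset.prod_const, Finset.card_univ, Fintype.card_fin]
  set L : History n T → ℝ := fun h => ∏ t, roundRatio q q' (h t) with hLdef
  have hRm := measurable_roundRatio (n := n) hqm hqm'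
  have hLm : Measurable L := by fun_prop
  have hL0 (h : History n T) : 0 < L h := Finset.prod_pos fun t _ => hR0 _
  have hL1 (h : History n T) : L h ≤ ((3 / 2) ^ n) ^ T := by
    simpa using Finset.prod_le_prod (s := Finset.univ) (fun t _ => (hR0 (h t)).le)
      (fun t _ => hR1 (h t))
  have hLi : Integrable L μ := integrable_of_measurable_bounded hLm fun h => by
    rw [abs_of_pos (hL0 h)]; exact hL1 h
  have hdens (t : ℕ) (a : Action n) : D'.demandLaw t a =
      (D.demandLaw t a).withDensity fun d => ENNReal.ofReal (roundRatio q q' (a, d)) :=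
    pi_bernoulliMeasure_eq_withDensity (fun i => q (a.1 i, a.2)) (fun i => q' (a.1 i, a.2))
      (fun i => Subtype.coe_lt_coe.1 (lt_of_lt_of_le (by norm_num) (hq _).1))
      (fun i => Subtype.coe_lt_coe.1 (lt_of_le_of_lt (hq _).2 (by norm_num)))
      (fun i x => by linarith [(hr (a.1 i, a.2) x).1])
  have hchange {f : History n T → ℝ} (hf : Measurable f) (hf0 : ∀ h, 0 ≤ f h) :
      ∫ h, f h ∂(historyLaw A D' T) = ∫ h, L h * f h ∂μ := by
    rw [integral_eq_lintegral_of_nonneg_ae (Filter.Eventually.of_forall hf0)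
      hf.aestronglyMeasurable, integral_eq_lintegral_of_nonneg_ae
      (Filter.Eventually.of_forall fun h => mul_nonneg (hL0 h).le (hf0 h))
      (hLm.mul hf).aestronglyMeasurable,
      lintegral_historyLaw_of_density A D D' hRm.ennreal_ofReal hdens T hf.ennreal_ofReal]
    congr 1
    refine lintegral_congr fun h => ?_
    rw [ENNReal.ofReal_mul (hL0 h).le, hLdef,
      ENNReal.ofReal_prod_of_nonneg fun t _ => (hR0 (h t)).le]
  have hLone : ∫ h, L h ∂μ = 1 := by
    have := hchange (f := fun _ => 1) measurable_const fun _ => zero_le_one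
    simpa using this.symm
  let G : I × I → I → ℝ := fun y x =>
    (1 - bernoulliRatio (q y) (q' y) x) + 2 * (1 - bernoulliRatio (q y) (q' y) x) ^ 2
  let g : Round n → ℝ := fun x => ∑ i, G (x.1.1 i, x.1.2) (x.2 i)
  have hGb (y : I × I) (x : I) : |G y x| ≤ 1 := by
    obtain ⟨h1, h2⟩ := hr y x
    rw [abs_le]
    constructor <;> simp only [G] <;> nlinarith
  have hgb (x : Round n) : |g x| ≤ n := by
    refine (Finset.abs_sum_le_sum_abs _ _).trans ?_
    simpa using Finset.sum_le_card_nsmul Finset.univ _ 1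
      fun i _ => hGb (x.1.1 i, x.1.2) (x.2 i)
  have hgm : Measurable g := by
    simp only [g, G, bernoulliRatio]
    fun_prop
  have hGm (y : I × I) : Measurable (G y) := by
    simp only [G, bernoulliRatio]
    fun_prop
  have hvm : Measurable fun x : Round n => 12 * δ ^ 2 * visits φ x :=
    (measurable_visits hφm).const_mul _
  have hlog (h : History n T) : -Real.log (L h) ≤ ∑ t, g (h t) := by
    simp only [hLdef, g]
    rw [Real.log_prod fun t _ => (hR0 (h t)).ne', ← Finset.sum_neg_distrib]
    refine Finset.sum_le_sum fun t _ => ?_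
    rw [roundRatio, Real.log_prod fun i _ => (lt_of_lt_of_le (by norm_num) (hr _ _).1).ne',
      ← Finset.sum_neg_distrib]
    exact Finset.sum_le_sum fun i _ => neg_log_le_of_half_le (hr _ _).1
  -- Chain rule for the entropy: the bound is proved conditionally on each action. As `q * (1 - q) ≥
  -- 3 / 16` and `φ ^ 2 ≤ φ`, a market contributes at most `(32 / 3) * δ ^ 2 * φ`.
  have hent : ∫ h, ∑ t, g (h t) ∂μ ≤ 12 * δ ^ 2 * ∫ h, ∑ t, visits φ (h t) ∂μ := by
    rw [← integral_const_mul]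
    simp_rw [Finset.mul_sum]
    refine integral_sum_rounds_mono A D T hgm hvm (C' := 12 * δ ^ 2 * n) hgb (fun x => ?_)
      fun t a => ?_
    · rw [abs_of_nonneg (mul_nonneg (by positivity) (visits_nonneg hφ0 x))]
      exact mul_le_mul_of_nonneg_left (visits_le hφ1 x) (by positivity)
    · simp only [g, visits]
      rw [integral_const, probReal_univ, one_smul, Finset.mul_sum]
      refine (integral_sum_bernoulliDemand q hqm a (fun i => hGm (a.1 i, a.2))
        fun i => hGb (a.1 i, a.2)).trans_le ?_
      refine Finset.sum_le_sum fun i _ => ?_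
      obtain ⟨h1, h2⟩ := hq (a.1 i, a.2)
      have := bernoulliRatio_second_moment (q := q (a.1 i, a.2)) (q' := q' (a.1 i, a.2))
        (by linarith) (by linarith)
      have hv : (3 / 16 : ℝ) ≤ q (a.1 i, a.2) * (1 - q (a.1 i, a.2)) := by nlinarith
      refine this.trans_le ?_
      rw [hqq', div_le_iff₀ (by linarith)]
      have hp0 := hφ0 (a.1 i, a.2)
      have hp1 := hφ1 (a.1 i, a.2)
      have hp : φ (a.1 i, a.2) ^ 2 ≤ φ (a.1 i, a.2) := by nlinarith
      have hX : 0 ≤ δ ^ 2 * φ (a.1 i, a.2) := mul_nonneg (sq_nonneg _) hp0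
      have hY := mul_le_mul_of_nonneg_left hp (sq_nonneg δ)
      have hZ := mul_le_mul_of_nonneg_left hv hX
      nlinarith
  have hN0 (h : History n T) : 0 ≤ ∑ t, visits φ (h t) :=
    Finset.sum_nonneg fun t _ => visits_nonneg hφ0 _
  have hN1 (h : History n T) : ∑ t, visits φ (h t) ≤ n * T := by
    refine (Finset.sum_le_card_nsmul Finset.univ _ _ fun t _ => visits_le hφ1 (h t)).trans ?_
    simp [mul_comm]
  have hNm : Measurable fun h : History n T => ∑ t, visits φ (h t) :=
    Finset.measurable_sum _ fun t _ => (measurable_visits hφm).comp (measurable_pi_apply t)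
  have hNi : Integrable (fun h : History n T => ∑ t, visits φ (h t)) μ :=
    integrable_of_measurable_bounded hNm fun h => by rw [abs_of_nonneg (hN0 h)]; exact hN1 h
  have hgi : Integrable (fun h : History n T => ∑ t, g (h t)) μ :=
    integrable_sum_rounds A D T hgm hgb
  have htv := integral_abs_sub_one_le hLi hgi hL0 hLone hlog hs
  have hdi : Integrable (fun h => |L h - 1|) μ := (hLi.sub (integrable_const _)).abs
  rw [hchange hNm hN0]
  calc ∫ h, L h * ∑ t, visits φ (h t) ∂μ
      ≤ ∫ h, (∑ t, visits φ (h t) + n * T * |L h - 1|) ∂μ := by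
        refine integral_mono_of_nonneg
          (Filter.Eventually.of_forall fun h => mul_nonneg (hL0 h).le (hN0 h))
          (hNi.add (hdi.const_mul _)) (Filter.Eventually.of_forall fun h => ?_)
        -- With `N` the number of visits, `L * N = N + (L - 1) * N` and `0 ≤ N ≤ n * T`.
        have h1 := mul_le_mul_of_nonneg_right (le_abs_self (L h - 1)) (hN0 h)
        have h2 := mul_le_mul_of_nonneg_left (hN1 h) (abs_nonneg (L h - 1))
        simp only
        linarith
    _ = ∫ h, ∑ t, visits φ (h t) ∂μ + n * T * ∫ h, |L h - 1| ∂μ := by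
        rw [integral_add hNi (hdi.const_mul _), integral_const_mul]
    _ ≤ _ := by
        gcongr
        refine htv.trans ?_
        gcongr

end TwoPoint

/-! ### The family of bump demands and its monotonicity. -/

/-- The tent function of height and radius one. -/
def tent (x : ℝ) : ℝ := max 0 (1 - |x|)

theorem tent_nonneg (x : ℝ) : 0 ≤ tent x := le_max_left _ _

theorem tent_le_one (x : ℝ) : tent x ≤ 1 := max_le zero_le_one (by linarith [abs_nonneg x])

theorem tent_zero : tent 0 = 1 := by simp [tent]

theorem continuous_tent : Continuous tent := by
  unfold tent
  fun_prop

theorem abs_tent_sub_le (x y : ℝ) : |tent x - tent y| ≤ |x - y| := by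
  unfold tent
  refine (abs_max_sub_max_le_max _ _ _ _).trans ?_
  have : |1 - |x| - (1 - |y|)| ≤ |x - y| := by
    rw [sub_sub_sub_cancel_left, abs_sub_comm]
    exact abs_abs_sub_abs_le x y
  simpa using this

/-- Tents of radius one centred at distinct even integers have disjoint supports, so at most one
term is nonzero. -/
theorem sum_tent_le_one (x : ℝ) (K : ℕ) : ∑ a ∈ Finset.range K, tent (x - 2 * a) ≤ 1 := by
  by_cases h : ∃ a ∈ Finset.range K, tent (x - 2 * a) ≠ 0
  · obtain ⟨a, ha, hne⟩ := h
    have key {b : ℕ} (hb : tent (x - 2 * b) ≠ 0) : |x - 2 * b| < 1 := by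
      by_contra! hc
      exact hb (max_eq_left (by linarith))
    rw [Finset.sum_eq_single_of_mem a ha]
    · exact tent_le_one _
    · intro b _ hba
      by_contra hb
      have h1 := abs_lt.1 (key hne)
      have h2 := abs_lt.1 (key hb)
      have h3 : (a : ℝ) < b + 1 := by linarith
      have h4 : (b : ℝ) < a + 1 := by linarith
      norm_cast at h3 h4
      omega
  · push Not at h
    rw [Finset.sum_eq_zero h]
    exact zero_le_one

/-- The bump on the cell with index `(a, b)` of the grid of `K * K` cells in the region of
expenditures at most `1/8` and prices at least `1/2`. -/
def bump (K a b : ℕ) (y : I × I) : ℝ :=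
  tent (16 * K * min (y.1 : ℝ) (1 / 8) - 2 * a) *
    tent (16 * K * (max (y.2 : ℝ) (1 / 2) - 1 / 2) - 2 * b)

theorem bump_nonneg (K a b : ℕ) (y : I × I) : 0 ≤ bump K a b y :=
  mul_nonneg (tent_nonneg _) (tent_nonneg _)

theorem bump_le_one (K a b : ℕ) (y : I × I) : bump K a b y ≤ 1 :=
  mul_le_one₀ (tent_le_one _) (tent_nonneg _) (tent_le_one _)

theorem measurable_bump (K a b : ℕ) : Measurable (bump K a b) := by
  have := continuous_tent.measurable
  unfold bump
  fun_prop

theorem sum_bump_le_one (K : ℕ) (y : I × I) :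
    ∑ k ∈ Finset.range K ×ˢ Finset.range K, bump K k.1 k.2 y ≤ 1 := by
  simp only [bump, Finset.sum_product]
  rw [← Finset.sum_mul_sum]
  exact mul_le_one₀ (sum_tent_le_one _ _) (Finset.sum_nonneg fun _ _ => tent_nonneg _)
    (sum_tent_le_one _ _)

/-- The mean demand at which the profit is the constant `1/4` on the region of expenditures at
most `1/8` and prices at least `1/2`. -/
def flatMean (y : I × I) : ℝ := (1 / 4 + min (y.1 : ℝ) (1 / 8)) / max (y.2 : ℝ) (1 / 2)

theorem flatMean_mem (y : I × I) : 1 / 4 ≤ flatMean y ∧ flatMean y ≤ 3 / 4 := by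
  have h1 : 1 / 2 ≤ max (y.2 : ℝ) (1 / 2) := le_max_right _ _
  have h2 : max (y.2 : ℝ) (1 / 2) ≤ 1 := max_le y.2.2.2 (by norm_num)
  have h3 : 0 ≤ min (y.1 : ℝ) (1 / 8) := le_min y.1.2.1 (by norm_num)
  have h4 : min (y.1 : ℝ) (1 / 8) ≤ 1 / 8 := min_le_right _ _
  unfold flatMean
  constructor
  · rw [le_div_iff₀ (by linarith)]; linarith
  · rw [div_le_iff₀ (by linarith)]; linarith

/-- `flatMean` as a point of the unit interval. -/
def flatDemand (y : I × I) : I :=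
  ⟨flatMean y, by linarith [(flatMean_mem y).1], by linarith [(flatMean_mem y).2]⟩

theorem measurable_flatDemand : Measurable flatDemand := by
  refine Measurable.subtype_mk ?_
  unfold flatMean
  fun_prop

/-- The height of the bumps. -/
def bumpHeight (K : ℕ) : ℝ := 1 / (64 * K)

theorem bumpHeight_mem (K : ℕ) : 0 ≤ bumpHeight K ∧ bumpHeight K ≤ 1 / 64 := by
  unfold bumpHeight
  refine ⟨by positivity, ?_⟩
  -- For `K = 0` the height is `0`, by the convention for division by zero.
  rcases Nat.eq_zero_or_pos K with rfl | h
  · norm_num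
  · have : (1 : ℝ) ≤ K := by exact_mod_cast h
    rw [div_le_div_iff₀ (by linarith) (by norm_num)]
    linarith

theorem bumpHeight_mul_bump_mem (K a b : ℕ) (y : I × I) :
    0 ≤ bumpHeight K * bump K a b y ∧ bumpHeight K * bump K a b y ≤ 1 / 64 := by
  obtain ⟨h1, h2⟩ := bumpHeight_mem K
  have := bump_nonneg K a b y
  have := bump_le_one K a b y
  exact ⟨by positivity, by nlinarith⟩

/-- The flat mean demand with a bump on one cell. -/
def bumpDemand (K a b : ℕ) (y : I × I) : I :=
  ⟨flatMean y + bumpHeight K * bump K a b y,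
    by linarith [(flatMean_mem y).1, (bumpHeight_mul_bump_mem K a b y).1],
    by linarith [(flatMean_mem y).2, (bumpHeight_mul_bump_mem K a b y).2]⟩

theorem measurable_bumpDemand (K a b : ℕ) : Measurable (bumpDemand K a b) := by
  refine Measurable.subtype_mk ?_
  have := measurable_bump K a b
  unfold flatMean
  fun_prop

/-- The height `1 / (64 * K)` times the scale `16 * K` is the slope 1/4; `u` stands for the tent in
the other coordinate. -/
theorem bumpHeight_mul_tent_sub_le (K : ℕ) (x y z : ℝ) {u : ℝ} (hu0 : 0 ≤ u) (hu1 : u ≤ 1) :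
    bumpHeight K * (u * (tent (16 * K * x - z) - tent (16 * K * y - z))) ≤ |x - y| / 4 := by
  have h1 := (le_abs_self _).trans (abs_tent_sub_le (16 * K * x - z) (16 * K * y - z))
  rw [sub_sub_sub_cancel_right, ← mul_sub, abs_mul, abs_of_nonneg (by positivity)] at h1
  have h2 : u * (tent (16 * K * x - z) - tent (16 * K * y - z)) ≤ 16 * K * |x - y| := by
    refine (mul_le_mul_of_nonneg_left h1 hu0).trans (mul_le_of_le_one_left (by positivity) hu1)
  refine (mul_le_mul_of_nonneg_left h2 (bumpHeight_mem K).1).trans ?_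
  unfold bumpHeight
  rcases Nat.eq_zero_or_pos K with rfl | h
  · simp only [Nat.cast_zero, mul_zero, div_zero, zero_mul]
    positivity
  · have : (K : ℝ) ≠ 0 := by positivity
    refine le_of_eq ?_
    field_simp
    ring

theorem monotone_bumpDemand (K a b : ℕ) (p : I) :
    Monotone fun x : I => (bumpDemand K a b (x, p) : ℝ) := by
  intro x y hxy
  have hxy' : (x : ℝ) ≤ y := hxy
  have hm : min (x : ℝ) (1 / 8) ≤ min (y : ℝ) (1 / 8) := min_le_min_right _ hxy'
  have h1 : 1 / 2 ≤ max (p : ℝ) (1 / 2) := le_max_right _ _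
  have h2 : max (p : ℝ) (1 / 2) ≤ 1 := max_le p.2.2 (by norm_num)
  simp only [bumpDemand, flatMean, bump]
  generalize min (x : ℝ) (1 / 8) = x' at *
  generalize min (y : ℝ) (1 / 8) = y' at *
  generalize max (p : ℝ) (1 / 2) = p' at *
  have h3 := bumpHeight_mul_tent_sub_le K x' y' (2 * a)
    (tent_nonneg (16 * K * (p' - 1 / 2) - 2 * b)) (tent_le_one _)
  rw [abs_sub_comm, abs_of_nonneg (by linarith)] at h3
  -- The flat mean has slope `1 / p' ≥ 1` in the truncated expenditure, which outweighs the slope of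
  -- the bump.
  have h4 : y' - x' ≤ (1 / 4 + y') / p' - (1 / 4 + x') / p' := by
    rw [← sub_div, le_div_iff₀ (by linarith)]
    nlinarith
  nlinarith

theorem antitone_bumpDemand (K a b : ℕ) (x : I) :
    Antitone fun p : I => (bumpDemand K a b (x, p) : ℝ) := by
  intro p r hpr
  have hpr' : (p : ℝ) ≤ r := hpr
  have hm : max (p : ℝ) (1 / 2) ≤ max (r : ℝ) (1 / 2) := max_le_max_right _ hpr'
  have h1 : 1 / 2 ≤ max (p : ℝ) (1 / 2) := le_max_right _ _
  have h2 : max (r : ℝ) (1 / 2) ≤ 1 := max_le r.2.2 (by norm_num)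
  have h0 : 0 ≤ min (x : ℝ) (1 / 8) := le_min x.2.1 (by norm_num)
  simp only [bumpDemand, flatMean, bump]
  generalize min (x : ℝ) (1 / 8) = x' at *
  generalize max (p : ℝ) (1 / 2) = p' at *
  generalize max (r : ℝ) (1 / 2) = r' at *
  have h3 := bumpHeight_mul_tent_sub_le K (r' - 1 / 2) (p' - 1 / 2) (2 * b)
    (tent_nonneg (16 * K * x' - 2 * a)) (tent_le_one _)
  rw [sub_sub_sub_cancel_right, abs_of_nonneg (by linarith)] at h3
  -- The right side is `(1 / 4 + x') * (r' - p') / (p' * r')`. This rate of decrease, at least 1/4,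
  -- is what limits the slope of the bump.
  have h4 : (r' - p') / 4 ≤ (1 / 4 + x') / p' - (1 / 4 + x') / r' := by
    have hp : 0 < p' := by linarith
    have hr : 0 < r' := by linarith
    rw [div_sub_div _ _ hp.ne' hr.ne', le_div_iff₀ (by positivity)]
    have h5 : p' * r' ≤ 1 := by nlinarith
    nlinarith [mul_le_mul_of_nonneg_left h5 (show 0 ≤ r' - p' by linarith),
      mul_nonneg h0 (show 0 ≤ r' - p' by linarith)]
  nlinarith

/-- The environment with the bump on the cell `(a, b)`. -/
def bumpEnv (n K a b : ℕ) : Environment n :=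
  bernoulliEnv n (bumpDemand K a b) (measurable_bumpDemand K a b)

theorem monotonic_bumpEnv (K a b : ℕ) : (bumpEnv n K a b).Monotonic := by
  intro t i
  refine ⟨fun p => ?_, fun x => ?_⟩
  · simp_rw [bumpEnv, meanDemand_bernoulliEnv]
    exact monotone_bumpDemand K a b p
  · simp_rw [bumpEnv, meanDemand_bernoulliEnv]
    exact antitone_bumpDemand K a b x

/-! ### Profits, the best fixed action and regret. -/

/-- Truncation makes profits outside the flat region no better: spending above 1/8 or pricing below
1/2 brings no additional demand. -/
theorem profit_bumpDemand_le (K a b : ℕ) (y : I × I) :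
    (y.2 : ℝ) * bumpDemand K a b y - y.1 ≤ 1 / 4 + bumpHeight K * bump K a b y := by
  have h1 : (y.2 : ℝ) ≤ max (y.2 : ℝ) (1 / 2) := le_max_left _ _
  have h2 : max (y.2 : ℝ) (1 / 2) ≤ 1 := max_le y.2.2.2 (by norm_num)
  have h3 : 1 / 2 ≤ max (y.2 : ℝ) (1 / 2) := le_max_right _ _
  have h4 : min (y.1 : ℝ) (1 / 8) ≤ y.1 := min_le_left _ _
  have h5 : max (y.2 : ℝ) (1 / 2) * flatMean y = 1 / 4 + min (y.1 : ℝ) (1 / 8) := by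
    unfold flatMean
    field_simp
  have h6 := (bumpHeight_mul_bump_mem K a b y).1
  have h7 := mul_le_mul_of_nonneg_right h1 (bumpDemand K a b y).2.1
  simp only [bumpDemand] at h7 ⊢
  nlinarith [mul_le_mul_of_nonneg_right h2 h6]

theorem integral_realizedProfit_bumpEnv_le (A : Algorithm n) (T K a b : ℕ) :
    ∫ h, realizedProfit h ∂(historyLaw A (bumpEnv n K a b) T) ≤
      n * T * (1 / 4) +
        bumpHeight K * ∫ h, ∑ t, visits (bump K a b) (h t) ∂(historyLaw A (bumpEnv n K a b) T) := by
  have hvm := measurable_visits (n := n) (measurable_bump K a b)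
  have hv0 := visits_nonneg (n := n) (bump_nonneg K a b)
  have hv1 := visits_le (n := n) (bump_le_one K a b)
  obtain ⟨hd0, hd1⟩ := bumpHeight_mem K
  have hb (a : Action n) (i : Fin n) (x : I) : |(a.2 : ℝ) * x - a.1 i| ≤ 1 := by
    have h1 := a.2.2
    have h2 := x.2
    have h3 := (a.1 i).2
    rw [abs_le]
    constructor <;>
      nlinarith [mul_nonneg h1.1 h2.1, mul_le_mul_of_nonneg_left h2.2 h1.1, h1.2, h3.1, h3.2]
  calc ∫ h, realizedProfit h ∂(historyLaw A (bumpEnv n K a b) T)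
      ≤ ∫ h, ∑ t, (n * (1 / 4) + bumpHeight K * visits (bump K a b) (h t))
          ∂(historyLaw A (bumpEnv n K a b) T) := by
        refine integral_sum_rounds_mono A (bumpEnv n K a b) T (C := n)
          (C' := n * (1 / 4) + bumpHeight K * n)
          (g := fun x : Round n => ∑ i, ((x.1.2 : ℝ) * x.2 i - x.1.1 i))
          (g' := fun x : Round n => n * (1 / 4) + bumpHeight K * visits (bump K a b) x)
          (by fun_prop) (by fun_prop) (fun x => ?_) (fun x => ?_) fun t α => ?_
        · refine (Finset.abs_sum_le_sum_abs _ _).trans ?_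
          simpa using Finset.sum_le_card_nsmul Finset.univ _ 1 fun i _ => hb x.1 i (x.2 i)
        · have := mul_nonneg hd0 (hv0 x)
          rw [abs_of_nonneg (by positivity)]
          gcongr
          exact hv1 x
        · refine (integral_sum_bernoulliDemand (bumpDemand K a b) (measurable_bumpDemand K a b) α
            (g := fun i x => (α.2 : ℝ) * x - α.1 i) (fun i => by fun_prop)
            (fun i => hb α i)).trans_le ?_
          simp only [visits]
          rw [integral_const, probReal_univ, one_smul, Finset.mul_sum]
          have : (n : ℝ) * (1 / 4) = ∑ i : Fin n, (1 / 4 : ℝ) := by simp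
          rw [this, ← Finset.sum_add_distrib]
          refine Finset.sum_le_sum fun i _ => ?_
          have := profit_bumpDemand_le K a b (α.1 i, α.2)
          simp only [Set.Icc.coe_one, Set.Icc.coe_zero] at this ⊢
          linarith
    _ = _ := by
        simp_rw [Finset.sum_add_distrib, ← Finset.mul_sum]
        rw [integral_add (integrable_const _) ((integrable_sum_rounds A _ T hvm (C := n)
          fun x => by rw [abs_of_nonneg (hv0 x)]; exact hv1 x).const_mul _), integral_const_mul, integral_const_mul]
        rw [integral_const, probReal_univ, one_smul, Finset.sum_const, Finset.card_univ,
          Fintype.card_fin, nsmul_eq_mul, mul_assoc]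

theorem le_opt_bumpEnv (T : ℕ) {K a b : ℕ} (ha : a < K) (hb : b < K) :
    n * T * (1 / 4 + bumpHeight K / 2) ≤ (bumpEnv n K a b).opt T := by
  have hK : (0 : ℝ) < K := by exact_mod_cast (Nat.zero_le a).trans_lt ha
  have ha' : (a : ℝ) / (8 * K) ≤ 1 / 8 := by
    have : (a : ℝ) ≤ K := by exact_mod_cast ha.le
    rw [div_le_div_iff₀ (by positivity) (by norm_num)]; linarith
  have hb' : (b : ℝ) / (8 * K) ≤ 1 / 8 := by
    have : (b : ℝ) ≤ K := by exact_mod_cast hb.le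
    rw [div_le_div_iff₀ (by positivity) (by norm_num)]; linarith
  have ha0 : 0 ≤ (a : ℝ) / (8 * K) := by positivity
  have hb0 : 0 ≤ (b : ℝ) / (8 * K) := by positivity
  -- The centre of the bump. The price there is at least 1/2, so the bump adds at least half its
  -- height to the profit.
  let x : I := ⟨a / (8 * K), ha0, by linarith⟩
  let p : I := ⟨1 / 2 + b / (8 * K), by linarith, by linarith⟩
  have hx : min (x : ℝ) (1 / 8) = a / (8 * K) := min_eq_left ha'
  have hp : max (p : ℝ) (1 / 2) = 1 / 2 + b / (8 * K) := max_eq_left (by simp only [p]; linarith)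
  have hbump : bump K a b (x, p) = 1 := by
    have e1 : 16 * (K : ℝ) * (a / (8 * K)) - 2 * a = 0 := by field_simp; ring
    have e2 : 16 * (K : ℝ) * (1 / 2 + b / (8 * K) - 1 / 2) - 2 * b = 0 := by field_simp; ring
    simp only [bump, hx, hp, e1, e2, tent_zero, mul_one]
  have hprofit : 1 / 4 + bumpHeight K / 2 ≤ (p : ℝ) * bumpDemand K a b (x, p) - x := by
    have e : (1 / 2 + (b : ℝ) / (8 * K)) * ((1 / 4 + a / (8 * K)) / (1 / 2 + b / (8 * K))) =
        1 / 4 + a / (8 * K) := mul_div_cancel₀ _ (by linarith)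
    have := mul_nonneg hb0 (bumpHeight_mem K).1
    simp only [bumpDemand, flatMean, hbump, hx, hp]
    simp only [x, p]
    linarith
  refine le_trans ?_ (le_ciSup ((bumpEnv n K a b).bddAbove_fixedProfit T) (fun _ => x, p))
  simp only [Environment.fixedProfit, bumpEnv, meanDemand_bernoulliEnv, Finset.sum_const,
    Finset.card_univ, Fintype.card_fin, Finset.card_range, nsmul_eq_mul]
  rw [mul_comm (n : ℝ), mul_assoc]
  gcongr

/-- Pigeonhole: the bumps sum to at most one at every point, so the expected visits to the `K ^ 2`
cells sum to at most `n * T`. -/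
theorem exists_cell_few_visits (A : Algorithm n) (D : Environment n) (T : ℕ) {K : ℕ} (hK : 0 < K) :
    ∃ a < K, ∃ b < K,
      ∫ h, ∑ t, visits (bump K a b) (h t) ∂(historyLaw A D T) ≤ n * T / (K : ℝ) ^ 2 := by
  have hi (k : ℕ × ℕ) : Integrable (fun h : History n T => ∑ t, visits (bump K k.1 k.2) (h t))
      (historyLaw A D T) :=
    integrable_sum_rounds A D T (measurable_visits (measurable_bump K k.1 k.2)) (C := n) fun x => by
      rw [abs_of_nonneg (visits_nonneg (bump_nonneg _ _ _) x)]
      exact visits_le (bump_le_one _ _ _) x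
  have hK' : (K : ℝ) ≠ 0 := by positivity
  obtain ⟨k, hk, hle⟩ := Finset.exists_le_of_sum_le (s := Finset.range K ×ˢ Finset.range K)
    (f := fun k => ∫ h, ∑ t, visits (bump K k.1 k.2) (h t) ∂(historyLaw A D T))
    (g := fun _ => n * T / (K : ℝ) ^ 2) ⟨(0, 0), by simp [hK]⟩ (by
      rw [← integral_finsetSum _ fun k _ => hi k]
      have h1 : ∀ h : History n T, ∑ k ∈ Finset.range K ×ˢ Finset.range K,
          ∑ t, visits (bump K k.1 k.2) (h t) ≤ n * T := fun h => by
        rw [Finset.sum_comm]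
        unfold visits
        rw [Finset.sum_congr rfl fun t _ => Finset.sum_comm]
        calc _ ≤ ∑ t : Fin T, ∑ i : Fin n, (1 : ℝ) :=
              Finset.sum_le_sum fun t _ => Finset.sum_le_sum fun i _ => sum_bump_le_one K _
          _ = n * T := by simp [mul_comm]
      refine (integral_mono (integrable_finsetSum _ fun k _ => hi k)
        (integrable_const (n * T : ℝ)) h1).trans (le_of_eq ?_)
      simp
      field_simp)
  rw [Finset.mem_product, Finset.mem_range, Finset.mem_range] at hk
  exact ⟨k.1, hk.1, k.2, hk.2, hle⟩

/-- Against every algorithm, one of the environments with a bump forces a large regret. -/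
theorem exists_monotonic_le_regret (A : Algorithm n) (T : ℕ) {K : ℕ} (hK : 2 ≤ K)
    (hT : (n * T : ℝ) ≤ (K : ℝ) ^ 4) :
    ∃ D : Environment n, D.Monotonic ∧ n * T / (512 * K : ℝ) ≤ regret A D T := by
  obtain ⟨a, ha, b, hb, hN⟩ := exists_cell_few_visits A
    (bernoulliEnv n flatDemand measurable_flatDemand) T (show 0 < K by omega)
  refine ⟨bumpEnv n K a b, monotonic_bumpEnv K a b, ?_⟩
  obtain ⟨hd0, hd1⟩ := bumpHeight_mem K
  -- With `s = 1 / 40` the excess of visits is at most `n * T * (240 / 4096 + 1 / 20)`, below `n * T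
  -- / 8`.
  have h1 := integral_visits_le A T measurable_flatDemand (measurable_bumpDemand K a b)
    (measurable_bump K a b) flatMean_mem (bump_nonneg K a b) (bump_le_one K a b)
    hd0 (hd1.trans (by norm_num)) (fun y => rfl) (show (0 : ℝ) < 1 / 40 by norm_num)
  have h2 := integral_realizedProfit_bumpEnv_le A T K a b
  have h3 := le_opt_bumpEnv (n := n) T ha hb
  change ∫ h, _ ∂(historyLaw A (bumpEnv n K a b) T) ≤ _ at h1
  unfold regret
  generalize ∫ h, ∑ t, visits (bump K a b) (h t)
    ∂(historyLaw A (bernoulliEnv n flatDemand measurable_flatDemand) T) = N at *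
  generalize ∫ h, ∑ t, visits (bump K a b) (h t) ∂(historyLaw A (bumpEnv n K a b) T) = N' at *
  generalize ∫ h, realizedProfit h ∂(historyLaw A (bumpEnv n K a b) T) = P at *
  generalize (bumpEnv n K a b).opt T = O at *
  have hS : (0 : ℝ) ≤ n * T := by positivity
  generalize (n * T : ℝ) = S at *
  have hK' : (2 : ℝ) ≤ K := by exact_mod_cast hK
  have hent : bumpHeight K ^ 2 * N ≤ 1 / 4096 := by
    have : bumpHeight K ^ 2 * N ≤ bumpHeight K ^ 2 * ((K : ℝ) ^ 4 / K ^ 2) := by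
      refine mul_le_mul_of_nonneg_left (hN.trans ?_) (sq_nonneg _)
      gcongr
    refine this.trans (le_of_eq ?_)
    unfold bumpHeight
    field_simp
    norm_num
  -- Here `2 ≤ K` enters. The visits under the bump are then at most `(1 / 4 + 1 / 8) * S`, short of
  -- the `S / 2` needed to match the optimum; the gap `S / 8` times the height is the regret.
  have hN4 : N ≤ S / 4 := hN.trans (div_le_div_of_nonneg_left hS (by norm_num) (by nlinarith))
  have hN' : N' ≤ 3 / 8 * S := by
    have : 12 * bumpHeight K ^ 2 * N / (2 * (1 / 40)) + 2 * (1 / 40) ≤ 1 / 8 := by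
      rw [show 12 * bumpHeight K ^ 2 * N / (2 * (1 / 40)) + 2 * (1 / 40) =
        240 * (bumpHeight K ^ 2 * N) + 1 / 20 by ring]
      linarith
    nlinarith [mul_le_mul_of_nonneg_left this hS]
  have hfin : S / (512 * K) = bumpHeight K * (S / 8) := by
    unfold bumpHeight
    field_simp
    ring
  rw [hfin]
  nlinarith [mul_le_mul_of_nonneg_left hN' hd0]

end TargetedMarketing

end

/-! ### The choice of the grid size. -/

theorem theorem2 :
    ∃ κ : ℝ, 0 < κ ∧ ∀ n T : ℕ, 1 ≤ n → 1 ≤ T →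
      ((κ * ((n : ℝ) * (T : ℝ)) ^ (3 / 4 : ℝ) : ℝ) : EReal) ≤
        TargetedMarketing.minimaxRegret n T := by
  refine ⟨1 / 1536, by norm_num, fun n T hn hT => le_iInf fun A => ?_⟩
  have hS : (1 : ℝ) ≤ n * T := by exact_mod_cast Nat.mul_pos hn hT
  set x : ℝ := ((n : ℝ) * T) ^ (1 / 4 : ℝ) with hx
  have hx1 : 1 ≤ x := Real.one_le_rpow hS (by norm_num)
  have hx3 : ((n : ℝ) * T) ^ (3 / 4 : ℝ) = x ^ 3 := by
    rw [hx, ← Real.rpow_natCast, ← Real.rpow_mul (by linarith)]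
    norm_num
  have hx4 : (n : ℝ) * T = x ^ 4 := by
    rw [hx, ← Real.rpow_natCast, ← Real.rpow_mul (by linarith)]
    norm_num
  -- The grid size is `⌈x⌉₊ + 1`: at least 2, at least `x` so that `n * T ≤ K ^ 4`, and at most `x +
  -- 2 ≤ 3 * x`. Hence the constant `1 / (512 * 3) = 1 / 1536`.
  have hceil : 0 < ⌈x⌉₊ := Nat.ceil_pos.2 (by linarith)
  have hle : x ≤ (⌈x⌉₊ + 1 : ℕ) := (Nat.le_ceil x).trans (by exact_mod_cast Nat.le_succ _)
  have hK3 : ((⌈x⌉₊ + 1 : ℕ) : ℝ) ≤ 3 * x := by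
    have := Nat.ceil_lt_add_one (show 0 ≤ x by linarith)
    push_cast
    linarith
  obtain ⟨D, hD, hreg⟩ := TargetedMarketing.exists_monotonic_le_regret A T
    (K := ⌈x⌉₊ + 1) (by omega) (by rw [hx4]; gcongr)
  refine le_iSup_of_le ⟨D, hD⟩ (EReal.coe_le_coe_iff.2 (le_trans ?_ hreg))
  rw [hx3, hx4, le_div_iff₀ (by positivity)]
  have : 0 ≤ x ^ 3 := by positivity
  nlinarith [mul_le_mul_of_nonneg_left hK3 this]
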